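/- Let $A,Q,Q_f\in\mathbb{R}^{n\times n}$, $B\in\mathbb{R}^{n\times m}$, $\Xi\in\mathbb{R}^{n\times k}$, $R\in\mathbb{R}^{m\times m}$ and $\lambda>0$, where $Q$ and $Q_f$ are symmetric positive semidefinite (PSD) and $R$ is symmetric positive definite. For each horizon $T\in\mathbb{N}$ consider the Riccati recursion $$P_t = Q + A^\top\Big[I + P_{t+1}BR^{-1}B^\top - \tfrac1\lambda P_{t+1}\Xi\Xi^\top\Big]^{-1}P_{t+1}A,\qquad t=T-1,\ldots,0,\qquad P_T=Q_f,$$ and the algebraic Riccati equation (ARE) $$P = Q + A^\top\Big[I + PBR^{-1}B^\top - \tfrac1\lambda P\Xi\Xi^\top\Big]^{-1}PA .$$ Put $W := BR^{-1}B^\top-\tfrac1\lambda\Xi\Xi^\top$, $$F:=\begin{bmatrix}A&0\\-Q&I\end{bmatrix},\qquad G:=\begin{bmatrix}I&W\\0&A^\top\end{bmatrix}.$$ The stable deflating subspace of the pencil $(F,G)$ is the complex linear span of all vectors $c_l$ of Jordan chains $c_1,\ldots,c_l\in\mathbb{C}^{2n}$, $Fc_1=\gamma Gc_1$, $Fc_{j+1}=\gamma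 Gc_{j+1}+Gc_j$, with $|\gamma|<1$. Suppose that (i) for all $T$ and all $t\le T$, every eigenvalue of $\Xi^\top P_t\Xi$ is smaller than $\lambda$; (ii) $W\succeq0$ and $(A,\sqrt W)$ is stabilizable; (iii) $(A,\sqrt Q)$ is observable. Then the matrices inverted in the recursion are all nonsingular, the ARE has a unique symmetric PSD solution $P_{ss}$, and the recursion converges to it: $\lim_{T\to\infty}P_t=P_{ss}$ for every fixed $t$. Moreover, there are $V_1,V_2\in\mathbb{R}^{n\times n}$ such that the columns of $V=\begin{bmatrix}V_1\\V_2\end{bmatrix}$ span the stable deflating subspace of $(F,G)$, and $FV=GVM$ for some $M\in\mathbb{R}^{n\times n}$ all of whose eigenvalues lie in the open unit disc. For every real or complex such choice of $n\times n$ matrices $V_1,V_2$ whose columns (stacked) span this subspace, and likewise for all $n \times n$ matrices $V_1,V_2$ such that $V$ has rank $n$ and $FV=GVM$ for some $M$ with all eigenvalues in the open unit disc, $V_1$ is nonsingular and $$P_{ss}=V_2V_1^{-1}.$$ -/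

import Mathlib

open Matrix Filter Topology

noncomputable section

namespace MinimaxLQ

/-! ### Notions of linear systems theory -/

section Systems

variable {n m p : ℕ}

/-- A complex square matrix is (Schur) stable if all its eigenvalues lie in the open unit disc. -/
def IsSchurStable (M : Matrix (Fin n) (Fin n) ℂ) : Prop :=
  ∀ γ ∈ spectrum ℂ M, ‖γ‖ < 1

/-- The complex matrix with the same entries as a given real matrix. -/
def toComplex {ι κ : Type*} (M : Matrix ι κ ℝ) : Matrix ι κ ℂ :=
  M.map (fun r : ℝ => (r : ℂ))

/-- `(A, B)` is stabilizable: some linear state feedback `u = K x` makes the closed loop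
`A + B K` of `x⁺ = A x + B u` stable. -/
def IsStabilizable (A : Matrix (Fin n) (Fin n) ℝ) (B : Matrix (Fin n) (Fin m) ℝ) : Prop :=
  ∃ K : Matrix (Fin m) (Fin n) ℝ, IsSchurStable (toComplex (A + B * K))

/-- `(A, C)` is observable: the initial state of `x⁺ = A x`, `y = C x` is determined by the
output sequence `y_j = C A ^ j x₀`. -/
def IsObservable (A : Matrix (Fin n) (Fin n) ℝ) (C : Matrix (Fin p) (Fin n) ℝ) : Prop :=
  Function.Injective fun (x : Fin n → ℝ) (j : ℕ) => (C * A ^ j) *ᵥ x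

open scoped MatrixOrder in
/-- The positive semidefinite square root of a positive semidefinite matrix. -/
def psdSqrt (M : Matrix (Fin n) (Fin n) ℝ) : Matrix (Fin n) (Fin n) ℝ :=
  CFC.sqrt M

/-- `psdSqrt` is the positive semidefinite square root. -/
theorem psdSqrt_spec {M : Matrix (Fin n) (Fin n) ℝ} (hM : M.PosSemidef) :
    (psdSqrt M).PosSemidef ∧ psdSqrt M * psdSqrt M = M := by
  open scoped MatrixOrder in
  exact ⟨(CFC.sqrt_nonneg M).posSemidef, CFC.sqrt_mul_sqrt_self M hM.nonneg⟩

end Systems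

/-! ### The Riccati recursion and the algebraic Riccati equation -/

section Riccati

variable {n m k : ℕ} (A : Matrix (Fin n) (Fin n) ℝ) (B : Matrix (Fin n) (Fin m) ℝ)
  (Ξ : Matrix (Fin n) (Fin k) ℝ) (Q : Matrix (Fin n) (Fin n) ℝ)
  (R : Matrix (Fin m) (Fin m) ℝ) (lam : ℝ)

/-- `W = B R⁻¹ Bᵀ - (1/λ) Ξ Ξᵀ`. -/
def matW : Matrix (Fin n) (Fin n) ℝ :=
  B * R⁻¹ * Bᵀ - (1 / lam) • (Ξ * Ξᵀ)

/-- The matrix `I + P B R⁻¹ Bᵀ - (1/λ) P Ξ Ξᵀ` that is inverted in the Riccati recursion. -/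
def bracket (P : Matrix (Fin n) (Fin n) ℝ) : Matrix (Fin n) (Fin n) ℝ :=
  1 + P * B * R⁻¹ * Bᵀ - (1 / lam) • (P * Ξ * Ξᵀ)

/-- The right-hand side `Q + Aᵀ [I + P B R⁻¹ Bᵀ - (1/λ) P Ξ Ξᵀ]⁻¹ P A`. -/
def riccatiMap (P : Matrix (Fin n) (Fin n) ℝ) : Matrix (Fin n) (Fin n) ℝ :=
  Q + Aᵀ * (bracket B Ξ R lam P)⁻¹ * P * A

/-- The solution `P_t` (for `t ≤ T`) of the backward Riccati recursion with horizon `T` and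
terminal value `P_T = Qf`. -/
def riccati (Qf : Matrix (Fin n) (Fin n) ℝ) (T t : ℕ) : Matrix (Fin n) (Fin n) ℝ :=
  (riccatiMap A B Ξ Q R lam)^[T - t] Qf

/-- The terminal condition `P_T = Qf`. -/
theorem riccati_terminal (Qf : Matrix (Fin n) (Fin n) ℝ) (T : ℕ) :
    riccati A B Ξ Q R lam Qf T T = Qf := by
  simp [riccati]

/-- The recursion `P_t = Q + Aᵀ [I + P_{t+1} B R⁻¹ Bᵀ - (1/λ) P_{t+1} Ξ Ξᵀ]⁻¹ P_{t+1} A`. -/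
theorem riccati_backward (Qf : Matrix (Fin n) (Fin n) ℝ) {T t : ℕ} (h : t < T) :
    riccati A B Ξ Q R lam Qf T t =
      riccatiMap A B Ξ Q R lam (riccati A B Ξ Q R lam Qf T (t + 1)) := by
  have e : T - t = (T - (t + 1)) + 1 := by omega
  rw [riccati, riccati, e, Function.iterate_succ_apply']

/-- `P` solves the algebraic Riccati equation (the inverse in it being a genuine one). -/
def IsARESolution (P : Matrix (Fin n) (Fin n) ℝ) : Prop :=
  IsUnit (bracket B Ξ R lam P) ∧ P = riccatiMap A B Ξ Q R lam P

/-- `F = [A, 0; -Q, I]`. -/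
def pencilF : Matrix (Fin n ⊕ Fin n) (Fin n ⊕ Fin n) ℝ :=
  Matrix.fromBlocks A 0 (-Q) 1

/-- `G = [I, W; 0, Aᵀ]`. -/
def pencilG : Matrix (Fin n ⊕ Fin n) (Fin n ⊕ Fin n) ℝ :=
  Matrix.fromBlocks 1 (matW B Ξ R lam) 0 Aᵀ

end Riccati

/-! ### The stable deflating subspace of a matrix pencil -/

section Pencil

variable {ι : Type*} [Fintype ι]

/-- `v` is the last vector of a Jordan chain of the pencil `(F, G)` for the generalized eigenvalue
`γ`, that is, of `c₁, …, c_l` with `F c₁ = γ G c₁` and `F c_{j+1} = γ G c_{j+1} + G c_j`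
(put `c₀ = 0`). Chains of length one consist of a solution of `F v = γ G v`. -/
def IsRootVector (F G : Matrix ι ι ℂ) (γ : ℂ) (v : ι → ℂ) : Prop :=
  ∃ (l : ℕ) (c : ℕ → ι → ℂ), c 0 = 0 ∧ c l = v ∧
    ∀ j < l, F *ᵥ c (j + 1) = γ • (G *ᵥ c (j + 1)) + G *ᵥ c j

/-- The stable deflating subspace of the pencil `(F, G)`: the span of all generalized eigenvectors
and principal vectors for generalized eigenvalues `γ` with `|γ| < 1`. -/
def stableDeflatingSubspace (F G : Matrix ι ι ℂ) : Submodule ℂ (ι → ℂ) :=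
  Submodule.span ℂ {v | ∃ γ : ℂ, ‖γ‖ < 1 ∧ IsRootVector F G γ v}

/-- The columns of `V` span the stable deflating subspace of the pencil `(F, G)`. -/
def ColumnsSpanStable {n : ℕ} (F G : Matrix ι ι ℂ) (V : Matrix ι (Fin n) ℂ) : Prop :=
  Submodule.span ℂ (Set.range V.col) = stableDeflatingSubspace F G

end Pencil

end MinimaxLQ

end

open MinimaxLQ

/-!
The data `B`, `R`, `Ξ`, `λ` enter only through `W = B R⁻¹ Bᵀ - (1/λ) Ξ Ξᵀ`, and the recursion is
`P ↦ Q + Aᵀ (1 + P W)⁻¹ P A`; and since `W = S Sᵀ` is positive semidefinite, this is the Riccati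
recursion of the linear-quadratic regulator for `x⁺ = A x + S u` with stage cost
`xᵀ Q x + |u|²`. The matrix `1 + P W` is invertible for every positive semidefinite `P`.

With the closed loop `L = (1 + W P)⁻¹ A`, the Riccati map is `Q + Lᵀ P W P L + Lᵀ P L`
(`dareMap_eq_lyapunov`), and completing the square (`feedbackCost_sub_dareMap`) exhibits it as the
minimum over all feedbacks `K` of the affine monotone maps
`P ↦ Q + Kᵀ K + (A + S K)ᵀ P (A + S K)`. Hence it is monotone, and its iterates from `0` increase.
For a stabilizing `K` the iterates of the affine map converge to its fixed point, so the Riccati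
iterates from `0` are bounded and converge to a fixed point `P` (`exists_dareMap_fixedPoint`).

Observability makes the closed loop of every positive semidefinite fixed point stable
(`isSchurStable_closedLoop`). If `P`, `P'` are two of them, then `P - P' = Lᵀ (P - P') L'`, which
forces `P = P'`. Moreover the iterates from any start are squeezed between those from `0` and those
of the affine map of the optimal feedback for `P`, both of which tend to `P`.

Finally, the stable deflating subspace is the graph of `P` (`mem_stableDeflatingSubspace_iff`).
It contains the graph because `F V = G V L` for `V = [1; P]`, so that `V` carries the Jordan chains
of `L` to those of the pencil. Conversely, for a vector `(x, y)` of a Jordan chain with `|γ| < 1`,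
the deviation `z = y - P x` satisfies `z = γ Lᵀ z`, hence vanishes. So `V₂ = P V₁` as soon as the
columns of `[V₁; V₂]` lie in the subspace, and `V₁` is invertible because `[V₁; V₂]` has rank `n`.
-/

namespace MinimaxLQ

/-! ### The Riccati map and linear state feedback -/

section RiccatiAlgebra

variable {n : ℕ}

theorem posSemidef_transpose_mul_mul {P : Matrix (Fin n) (Fin n) ℝ} (hP : P.PosSemidef)
    (M : Matrix (Fin n) (Fin n) ℝ) : (Mᵀ * P * M).PosSemidef := by
  simpa using hP.conjTranspose_mul_mul_same M

theorem transpose_eq_of_posSemidef {P : Matrix (Fin n) (Fin n) ℝ} (hP : P.PosSemidef) : Pᵀ = P := by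
  simpa using hP.isHermitian.eq

/-- Writing `W = Cᵀ C`, the determinant is that of the positive definite matrix `1 + C P Cᵀ`. -/
theorem isUnit_one_add_mul {P W : Matrix (Fin n) (Fin n) ℝ} (hP : P.PosSemidef)
    (hW : W.PosSemidef) : IsUnit (1 + P * W) := by
  obtain ⟨C, rfl⟩ : ∃ C : Matrix (Fin n) (Fin n) ℝ, W = Cᵀ * C :=
    ⟨psdSqrt W, by rw [transpose_eq_of_posSemidef (psdSqrt_spec hW).1, (psdSqrt_spec hW).2]⟩
  have h : (1 + C * (P * Cᵀ)).PosDef := by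
    refine PosDef.one.add_posSemidef ?_
    simpa [Matrix.mul_assoc] using posSemidef_transpose_mul_mul hP Cᵀ
  rw [isUnit_iff_isUnit_det, ← Matrix.mul_assoc, det_one_add_mul_comm,
    ← isUnit_iff_isUnit_det]
  exact h.isUnit

/-- The right-hand side of the Riccati recursion in terms of `W = B R⁻¹ Bᵀ - (1/λ) Ξ Ξᵀ`. -/
noncomputable def dareMap (A W Q P : Matrix (Fin n) (Fin n) ℝ) : Matrix (Fin n) (Fin n) ℝ :=
  Q + Aᵀ * (1 + P * W)⁻¹ * P * A

/-- The closed-loop matrix `(1 + W P)⁻¹ A` of the optimal feedback for terminal cost `P`. -/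
noncomputable def closedLoop (A W P : Matrix (Fin n) (Fin n) ℝ) : Matrix (Fin n) (Fin n) ℝ :=
  (1 + W * P)⁻¹ * A

/-- The cost over one step of the feedback `u = K x` for `x⁺ = A x + S u`: the quadratic form of
`Q`, plus `‖u‖²`, plus the terminal cost `P` at `x⁺`. -/
def feedbackCost (A S Q K P : Matrix (Fin n) (Fin n) ℝ) : Matrix (Fin n) (Fin n) ℝ :=
  Q + Kᵀ * K + (A + S * K)ᵀ * P * (A + S * K)

/-- The optimal feedback gain for terminal cost `P`. -/
noncomputable def optimalGain (A S P : Matrix (Fin n) (Fin n) ℝ) : Matrix (Fin n) (Fin n) ℝ :=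
  -(Sᵀ * P * closedLoop A (S * Sᵀ) P)

variable {A W Q S P P' : Matrix (Fin n) (Fin n) ℝ}

theorem one_add_mul_closedLoop (hP : P.PosSemidef) (hW : W.PosSemidef) :
    (1 + W * P) * closedLoop A W P = A := by
  rw [closedLoop, mul_nonsing_inv_cancel_left _ _
    ((isUnit_iff_isUnit_det _).1 (isUnit_one_add_mul hW hP))]

theorem transpose_closedLoop_mul (hP : P.PosSemidef) (hW : W.PosSemidef) :
    (closedLoop A W P)ᵀ * (1 + P * W) = Aᵀ := by
  have h := congrArg transpose (one_add_mul_closedLoop (A := A) hP hW)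
  simpa [transpose_eq_of_posSemidef hP, transpose_eq_of_posSemidef hW] using h

theorem transpose_closedLoop (hP : P.PosSemidef) (hW : W.PosSemidef) :
    (closedLoop A W P)ᵀ = Aᵀ * (1 + P * W)⁻¹ := by
  rw [← transpose_closedLoop_mul (A := A) hP hW, mul_nonsing_inv_cancel_right _ _
    ((isUnit_iff_isUnit_det _).1 (isUnit_one_add_mul hP hW))]

theorem dareMap_eq_transpose_closedLoop (hP : P.PosSemidef) (hW : W.PosSemidef) :
    dareMap A W Q P = Q + (closedLoop A W P)ᵀ * P * A := by
  rw [dareMap, transpose_closedLoop hP hW]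

theorem dareMap_eq_lyapunov (hP : P.PosSemidef) (hW : W.PosSemidef) :
    dareMap A W Q P = Q + (closedLoop A W P)ᵀ * (P * W * P) * closedLoop A W P +
      (closedLoop A W P)ᵀ * P * closedLoop A W P := by
  rw [dareMap_eq_transpose_closedLoop hP hW]
  conv_lhs => rw [← one_add_mul_closedLoop (A := A) hP hW]
  have h : closedLoop (((1 + W * P) * closedLoop A W P)) W P = closedLoop A W P := by
    rw [one_add_mul_closedLoop hP hW]
  rw [h]
  noncomm_ring

theorem dareMap_eq_mul_closedLoop (hP : P.PosSemidef) (hW : W.PosSemidef) :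
    dareMap A W Q P = Q + Aᵀ * P * closedLoop A W P := by
  rw [dareMap_eq_lyapunov hP hW]
  conv_rhs => rw [← transpose_closedLoop_mul (A := A) hP hW]
  noncomm_ring

theorem posSemidef_dareMap (hQ : Q.PosSemidef) (hP : P.PosSemidef) (hW : W.PosSemidef) :
    (dareMap A W Q P).PosSemidef := by
  rw [dareMap_eq_lyapunov hP hW]
  refine (hQ.add (posSemidef_transpose_mul_mul ?_ _)).add (posSemidef_transpose_mul_mul hP _)
  simpa [transpose_eq_of_posSemidef hP] using posSemidef_transpose_mul_mul hW P

theorem dareMap_sub_dareMap (hP : P.PosSemidef) (hP' : P'.PosSemidef) (hW : W.PosSemidef) :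
    dareMap A W Q P - dareMap A W Q P' =
      (closedLoop A W P)ᵀ * (P - P') * closedLoop A W P' := by
  have h1 : (closedLoop A W P)ᵀ * P * A =
      (closedLoop A W P)ᵀ * P * ((1 + W * P') * closedLoop A W P') := by
    rw [one_add_mul_closedLoop hP' hW]
  rw [dareMap_eq_transpose_closedLoop hP hW, dareMap_eq_mul_closedLoop hP' hW, h1,
    ← transpose_closedLoop_mul (A := A) hP hW]
  noncomm_ring

theorem posSemidef_mul_transpose_self (S : Matrix (Fin n) (Fin n) ℝ) : (S * Sᵀ).PosSemidef := by
  simpa using posSemidef_self_mul_conjTranspose S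

theorem add_mul_optimalGain (hP : P.PosSemidef) :
    A + S * optimalGain A S P = closedLoop A (S * Sᵀ) P := by
  have h := one_add_mul_closedLoop (A := A) hP (posSemidef_mul_transpose_self S)
  nth_rw 1 [← h]
  rw [optimalGain]
  noncomm_ring

theorem transpose_optimalGain (hP : P.PosSemidef) :
    (optimalGain A S P)ᵀ = -((closedLoop A (S * Sᵀ) P)ᵀ * P * S) := by
  simp [optimalGain, transpose_eq_of_posSemidef hP, Matrix.mul_assoc]

theorem feedbackCost_optimalGain (hP : P.PosSemidef) :
    feedbackCost A S Q (optimalGain A S P) P = dareMap A (S * Sᵀ) Q P := by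
  rw [feedbackCost, add_mul_optimalGain hP, dareMap_eq_lyapunov hP
    (posSemidef_mul_transpose_self S), transpose_optimalGain hP, optimalGain]
  noncomm_ring

/-- Completing the square: the excess cost of a feedback `K` over the optimal one. -/
theorem feedbackCost_sub_dareMap (hP : P.PosSemidef) (K : Matrix (Fin n) (Fin n) ℝ) :
    feedbackCost A S Q K P - dareMap A (S * Sᵀ) Q P =
      (K - optimalGain A S P)ᵀ * (1 + Sᵀ * P * S) * (K - optimalGain A S P) := by
  obtain ⟨D, rfl⟩ : ∃ D, K = optimalGain A S P + D := ⟨K - optimalGain A S P, by abel⟩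
  have h : A + S * (optimalGain A S P + D) = closedLoop A (S * Sᵀ) P + S * D := by
    rw [← add_mul_optimalGain (A := A) hP]; noncomm_ring
  rw [← feedbackCost_optimalGain hP, feedbackCost, feedbackCost, h, add_mul_optimalGain hP,
    add_sub_cancel_left, transpose_add, transpose_add, transpose_mul, transpose_optimalGain hP,
    optimalGain]
  noncomm_ring

open scoped MatrixOrder

theorem dareMap_le_feedbackCost (hP : P.PosSemidef) (K : Matrix (Fin n) (Fin n) ℝ) :
    dareMap A (S * Sᵀ) Q P ≤ feedbackCost A S Q K P := by
  rw [Matrix.le_iff, feedbackCost_sub_dareMap hP]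
  exact posSemidef_transpose_mul_mul
    (PosSemidef.one.add (posSemidef_transpose_mul_mul hP S)) _

theorem feedbackCost_mono (K : Matrix (Fin n) (Fin n) ℝ) :
    Monotone (feedbackCost A S Q K) := by
  intro P P' h
  rw [Matrix.le_iff] at h ⊢
  have e : feedbackCost A S Q K P' - feedbackCost A S Q K P =
      (A + S * K)ᵀ * (P' - P) * (A + S * K) := by
    rw [feedbackCost, feedbackCost, Matrix.mul_sub, Matrix.sub_mul]
    abel
  rw [e]
  exact posSemidef_transpose_mul_mul h (A + S * K)

/-- Monotonicity of the Riccati map, as a minimum over feedbacks of monotone maps. -/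
theorem dareMap_le_dareMap (hP : P.PosSemidef) (hP' : P'.PosSemidef) (h : P ≤ P') :
    dareMap A (S * Sᵀ) Q P ≤ dareMap A (S * Sᵀ) Q P' := by
  rw [← feedbackCost_optimalGain hP']
  exact (dareMap_le_feedbackCost hP _).trans (feedbackCost_mono _ h)

theorem posSemidef_iterate_dareMap (hQ : Q.PosSemidef) (hW : W.PosSemidef) (hP : P.PosSemidef)
    (N : ℕ) : ((dareMap A W Q)^[N] P).PosSemidef := by
  induction N with
  | zero => exact hP
  | succ N ih =>
    rw [Function.iterate_succ_apply']
    exact posSemidef_dareMap hQ ih hW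

theorem iterate_dareMap_le (hQ : Q.PosSemidef) (hP : P.PosSemidef) (hP' : P'.PosSemidef)
    (h : P ≤ P') (N : ℕ) : (dareMap A (S * Sᵀ) Q)^[N] P ≤ (dareMap A (S * Sᵀ) Q)^[N] P' := by
  have hW := posSemidef_mul_transpose_self S
  induction N with
  | zero => exact h
  | succ N ih =>
    simp only [Function.iterate_succ_apply']
    exact dareMap_le_dareMap (posSemidef_iterate_dareMap hQ hW hP N)
      (posSemidef_iterate_dareMap hQ hW hP' N) ih

theorem iterate_dareMap_le_feedbackCost (hQ : Q.PosSemidef) (hP : P.PosSemidef)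
    (K : Matrix (Fin n) (Fin n) ℝ) (N : ℕ) :
    (dareMap A (S * Sᵀ) Q)^[N] P ≤ (feedbackCost A S Q K)^[N] P := by
  induction N with
  | zero => exact le_rfl
  | succ N ih =>
    simp only [Function.iterate_succ_apply']
    exact (dareMap_le_feedbackCost (posSemidef_iterate_dareMap hQ
      (posSemidef_mul_transpose_self S) hP N) K).trans (feedbackCost_mono K ih)

/-- The iterates from `0` increase. -/
theorem monotone_iterate_dareMap_zero (hQ : Q.PosSemidef) :
    Monotone fun N => (dareMap A (S * Sᵀ) Q)^[N] 0 := by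
  have hW := posSemidef_mul_transpose_self S
  refine monotone_nat_of_le_succ fun N => ?_
  rw [Function.iterate_succ_apply]
  exact iterate_dareMap_le hQ PosSemidef.zero (posSemidef_dareMap hQ PosSemidef.zero hW)
    (posSemidef_dareMap hQ PosSemidef.zero hW).nonneg N

end RiccatiAlgebra

/-! ### Stable matrices and limits of symmetric matrices -/

section Limits

variable {n : ℕ}

open scoped Matrix.Norms.Operator in
theorem IsSchurStable.tendsto_pow {M : Matrix (Fin n) (Fin n) ℂ} (hM : IsSchurStable M) :
    Tendsto (fun N => M ^ N) atTop (𝓝 0) := by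
  rcases subsingleton_or_nontrivial (Matrix (Fin n) (Fin n) ℂ) with h | h
  · simpa only [Subsingleton.elim (M ^ _) 0] using tendsto_const_nhds
  have hρ : spectralRadius ℂ M < 1 := by
    refine spectrum.spectralRadius_lt_of_forall_lt M (r := 1) fun γ hγ => ?_
    exact_mod_cast hM γ hγ
  obtain ⟨r, hr1, hr2⟩ := ENNReal.lt_iff_exists_nnreal_btwn.1 hρ
  have hr2' : (r : ℝ) < 1 := by exact_mod_cast hr2
  have hev := (spectrum.pow_nnnorm_pow_one_div_tendsto_nhds_spectralRadius M).eventually_lt_const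
    hr1
  refine squeeze_zero_norm' ?_ (tendsto_pow_atTop_nhds_zero_of_lt_one r.2 hr2')
  filter_upwards [hev, eventually_gt_atTop 0] with N hN hN0
  have h1 := ENNReal.rpow_lt_rpow hN (z := N) (by exact_mod_cast hN0)
  rw [← ENNReal.rpow_mul, one_div, inv_mul_cancel₀ (by exact_mod_cast hN0.ne'), ENNReal.rpow_one,
    ENNReal.rpow_natCast] at h1
  exact_mod_cast h1.le

theorem toComplex_mul {ι κ μ : Type*} [Fintype κ] (M : Matrix ι κ ℝ) (N : Matrix κ μ ℝ) :
    toComplex (M * N) = toComplex M * toComplex N :=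
  Matrix.map_mul (f := Complex.ofRealHom)

theorem toComplex_add {ι κ : Type*} (M N : Matrix ι κ ℝ) :
    toComplex (M + N) = toComplex M + toComplex N := by
  ext; simp [toComplex]

theorem toComplex_one {ι : Type*} [DecidableEq ι] : toComplex (1 : Matrix ι ι ℝ) = 1 :=
  Matrix.map_one _ Complex.ofReal_zero Complex.ofReal_one

theorem toComplex_transpose {ι κ : Type*} (M : Matrix ι κ ℝ) :
    toComplex Mᵀ = (toComplex M)ᵀ := rfl

theorem toComplex_conjTranspose {ι κ : Type*} (M : Matrix ι κ ℝ) :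
    (toComplex M)ᴴ = toComplex Mᵀ := by
  ext; simp [toComplex]

theorem toComplex_pow (M : Matrix (Fin n) (Fin n) ℝ) (N : ℕ) :
    toComplex (M ^ N) = toComplex M ^ N :=
  map_pow Complex.ofRealHom.mapMatrix M N

theorem tendsto_pow_of_isSchurStable {M : Matrix (Fin n) (Fin n) ℝ}
    (hM : IsSchurStable (toComplex M)) : Tendsto (fun N => M ^ N) atTop (𝓝 0) := by
  have hc : Continuous fun X : Matrix (Fin n) (Fin n) ℂ => X.map Complex.re :=
    continuous_id.matrix_map Complex.continuous_re
  have h := (hc.tendsto 0).comp hM.tendsto_pow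
  rw [Matrix.map_zero _ Complex.zero_re] at h
  refine h.congr fun N => ?_
  rw [Function.comp_apply, ← toComplex_pow]
  ext i j
  simp [toComplex]

theorem tendsto_transpose_pow_mul_mul {M M' : Matrix (Fin n) (Fin n) ℝ}
    (hM : IsSchurStable (toComplex M)) (hM' : IsSchurStable (toComplex M'))
    (X : Matrix (Fin n) (Fin n) ℝ) :
    Tendsto (fun N => (M ^ N)ᵀ * X * M' ^ N) atTop (𝓝 0) := by
  have h1 := tendsto_pow_of_isSchurStable hM
  have h2 := tendsto_pow_of_isSchurStable hM'
  have h3 : Tendsto (fun N => (M ^ N)ᵀ) atTop (𝓝 0) := by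
    have h := (continuous_id.matrix_transpose.tendsto (0 : Matrix (Fin n) (Fin n) ℝ)).comp h1
    rwa [id, transpose_zero] at h
  simpa using (h3.mul_const X).mul h2

/-- A solution of the homogeneous Sylvester equation vanishes, as it equals
`(Mᵀ) ^ N X M' ^ N` for all `N`. -/
theorem eq_zero_of_eq_transpose_mul_mul {M M' X : Matrix (Fin n) (Fin n) ℝ}
    (hM : IsSchurStable (toComplex M)) (hM' : IsSchurStable (toComplex M'))
    (hX : X = Mᵀ * X * M') : X = 0 := by
  have h : ∀ N : ℕ, (M ^ N)ᵀ * X * M' ^ N = X := by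
    intro N
    induction N with
    | zero => simp
    | succ N ih =>
      conv_rhs => rw [← ih, hX]
      rw [pow_succ' M, pow_succ' M', transpose_mul]
      simp only [Matrix.mul_assoc]
  exact tendsto_nhds_unique tendsto_const_nhds
    ((tendsto_transpose_pow_mul_mul hM hM' X).congr h)

/-- The Lyapunov operator `X ↦ X - Mᵀ X M` is injective, hence surjective. -/
theorem exists_lyapunov_solution {M : Matrix (Fin n) (Fin n) ℝ}
    (hM : IsSchurStable (toComplex M)) (C : Matrix (Fin n) (Fin n) ℝ) :
    ∃ X, X = C + Mᵀ * X * M := by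
  let L : Matrix (Fin n) (Fin n) ℝ →ₗ[ℝ] Matrix (Fin n) (Fin n) ℝ :=
    { toFun := fun X => X - Mᵀ * X * M
      map_add' := fun X Y => by noncomm_ring
      map_smul' := fun c X => by simp [smul_sub] }
  have hL : Function.Injective L := by
    rw [injective_iff_map_eq_zero]
    exact fun X hX => eq_zero_of_eq_transpose_mul_mul hM hM (sub_eq_zero.1 hX)
  obtain ⟨X, hX⟩ := LinearMap.surjective_of_injective hL C
  exact ⟨X, sub_eq_iff_eq_add.1 hX⟩

/-- If the feedback `K` stabilizes the system, its cost iterates converge to any fixed point. -/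
theorem tendsto_iterate_feedbackCost {A S Q K X : Matrix (Fin n) (Fin n) ℝ}
    (hK : IsSchurStable (toComplex (A + S * K))) (hX : X = feedbackCost A S Q K X)
    (P : Matrix (Fin n) (Fin n) ℝ) :
    Tendsto (fun N => (feedbackCost A S Q K)^[N] P) atTop (𝓝 X) := by
  have h : ∀ N : ℕ, (feedbackCost A S Q K)^[N] P =
      ((A + S * K) ^ N)ᵀ * (P - X) * (A + S * K) ^ N + X := by
    intro N
    induction N with
    | zero => simp
    | succ N ih =>
      rw [Function.iterate_succ_apply', ih]
      conv_rhs =>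
        enter [2]
        rw [hX]
      rw [feedbackCost, feedbackCost, pow_succ, transpose_mul]
      noncomm_ring
  have h2 := (tendsto_transpose_pow_mul_mul hK hK (P - X)).add_const X
  rw [zero_add] at h2
  exact h2.congr fun N => (h N).symm

theorem entry_eq_of_transpose_eq {M : Matrix (Fin n) (Fin n) ℝ} (hM : Mᵀ = M) (i j : Fin n) :
    M i j = ((Pi.single i 1 + Pi.single j 1) ⬝ᵥ M *ᵥ (Pi.single i 1 + Pi.single j 1)
      - Pi.single i 1 ⬝ᵥ M *ᵥ Pi.single i 1 - Pi.single j 1 ⬝ᵥ M *ᵥ Pi.single j 1) / 2 := by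
  have hs : M j i = M i j := congrFun (congrFun hM i) j
  simp [mulVec_add, hs]
  ring

/-- Symmetric matrices converge as soon as their quadratic forms do, by polarization. -/
theorem exists_tendsto_of_quadratic {u : ℕ → Matrix (Fin n) (Fin n) ℝ} (hu : ∀ N, (u N)ᵀ = u N)
    (h : ∀ x : Fin n → ℝ, ∃ l, Tendsto (fun N => x ⬝ᵥ u N *ᵥ x) atTop (𝓝 l)) :
    ∃ P, Tendsto u atTop (𝓝 P) := by
  choose l hl using h
  refine ⟨Matrix.of fun i j => (l (Pi.single i 1 + Pi.single j 1) - l (Pi.single i 1)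
    - l (Pi.single j 1)) / 2, ?_⟩
  refine tendsto_pi_nhds.2 fun i => tendsto_pi_nhds.2 fun j => ?_
  simp_rw [fun N => entry_eq_of_transpose_eq (hu N) i j]
  exact (((hl _).sub (hl _)).sub (hl _)).div_const 2

theorem tendsto_quadratic {u : ℕ → Matrix (Fin n) (Fin n) ℝ} {P : Matrix (Fin n) (Fin n) ℝ}
    (h : Tendsto u atTop (𝓝 P)) (x : Fin n → ℝ) :
    Tendsto (fun N => x ⬝ᵥ u N *ᵥ x) atTop (𝓝 (x ⬝ᵥ P *ᵥ x)) := by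
  have hc : Continuous fun M : Matrix (Fin n) (Fin n) ℝ => x ⬝ᵥ M *ᵥ x := by fun_prop
  exact (hc.tendsto P).comp h

theorem posSemidef_of_tendsto {u : ℕ → Matrix (Fin n) (Fin n) ℝ} {P : Matrix (Fin n) (Fin n) ℝ}
    (hu : ∀ N, (u N).PosSemidef) (h : Tendsto u atTop (𝓝 P)) : P.PosSemidef := by
  refine PosSemidef.of_dotProduct_mulVec_nonneg ?_ fun x => ?_
  · have h1 := (continuous_id.matrix_transpose.tendsto P).comp h
    have h2 : Pᵀ = P := tendsto_nhds_unique h1 (h.congr fun N =>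
      (transpose_eq_of_posSemidef (hu N)).symm)
    simpa [Matrix.IsHermitian] using h2
  · simpa using ge_of_tendsto' (tendsto_quadratic h x) fun N => by
      simpa using (hu N).dotProduct_mulVec_nonneg x

open scoped MatrixOrder

theorem quadratic_le_of_le {P P' : Matrix (Fin n) (Fin n) ℝ} (h : P ≤ P') (x : Fin n → ℝ) :
    x ⬝ᵥ P *ᵥ x ≤ x ⬝ᵥ P' *ᵥ x := by
  have := (Matrix.le_iff.1 h).dotProduct_mulVec_nonneg x
  simpa [sub_mulVec] using this

theorem exists_tendsto_of_monotone {u v : ℕ → Matrix (Fin n) (Fin n) ℝ}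
    {X : Matrix (Fin n) (Fin n) ℝ} (hu : ∀ N, (u N)ᵀ = u N) (hmono : Monotone u)
    (huv : ∀ N, u N ≤ v N) (hv : Tendsto v atTop (𝓝 X)) : ∃ P, Tendsto u atTop (𝓝 P) := by
  refine exists_tendsto_of_quadratic hu fun x => ?_
  have hm : Monotone fun N => x ⬝ᵥ u N *ᵥ x := fun a b hab => quadratic_le_of_le (hmono hab) x
  obtain ⟨b, hb⟩ := (tendsto_quadratic hv x).bddAbove_range
  exact ⟨_, tendsto_atTop_ciSup hm ⟨b, by
    rintro _ ⟨N, rfl⟩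
    exact (quadratic_le_of_le (huv N) x).trans (hb ⟨N, rfl⟩)⟩⟩

/-- The squeeze theorem for the Loewner order. -/
theorem tendsto_of_le_of_le {u v w : ℕ → Matrix (Fin n) (Fin n) ℝ}
    {P : Matrix (Fin n) (Fin n) ℝ} (hv : ∀ N, (v N)ᵀ = v N) (hPt : Pᵀ = P)
    (huv : ∀ N, u N ≤ v N) (hvw : ∀ N, v N ≤ w N)
    (hu : Tendsto u atTop (𝓝 P)) (hw : Tendsto w atTop (𝓝 P)) : Tendsto v atTop (𝓝 P) := by
  have h : ∀ x : Fin n → ℝ, Tendsto (fun N => x ⬝ᵥ v N *ᵥ x) atTop (𝓝 (x ⬝ᵥ P *ᵥ x)) :=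
    fun x => tendsto_of_tendsto_of_tendsto_of_le_of_le (tendsto_quadratic hu x)
      (tendsto_quadratic hw x) (fun N => quadratic_le_of_le (huv N) x)
      (fun N => quadratic_le_of_le (hvw N) x)
  refine tendsto_pi_nhds.2 fun i => tendsto_pi_nhds.2 fun j => ?_
  simp_rw [fun N => entry_eq_of_transpose_eq (hv N) i j]
  rw [entry_eq_of_transpose_eq hPt i j]
  exact (((h _).sub (h _)).sub (h _)).div_const 2

open scoped Matrix.Norms.Operator in
theorem continuousAt_dareMap {A W Q P : Matrix (Fin n) (Fin n) ℝ} (hP : P.PosSemidef)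
    (hW : W.PosSemidef) : ContinuousAt (dareMap A W Q) P := by
  have h1 : ContinuousAt (fun X : Matrix (Fin n) (Fin n) ℝ => (1 + X * W)⁻¹) P := by
    obtain ⟨U, hU⟩ := isUnit_one_add_mul hP hW
    have h := NormedRing.inverse_continuousAt U
    rw [hU] at h
    simp_rw [nonsing_inv_eq_ringInverse]
    have hc : ContinuousAt (fun X : Matrix (Fin n) (Fin n) ℝ => 1 + X * W) P := by fun_prop
    exact ContinuousAt.comp (f := fun X : Matrix (Fin n) (Fin n) ℝ => 1 + X * W) h hc
  exact continuousAt_const.add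
    (((continuousAt_const.mul h1).mul continuousAt_id).mul continuousAt_const)

end Limits

/-! ### Stability of the closed loop under observability -/

section Observability

variable {n : ℕ}

theorem exists_mulVec_eq_smul_of_mem_spectrum {M : Matrix (Fin n) (Fin n) ℂ} {γ : ℂ}
    (h : γ ∈ spectrum ℂ M) : ∃ v ≠ 0, M *ᵥ v = γ • v := by
  rw [spectrum.mem_iff, isUnit_iff_isUnit_det, isUnit_iff_ne_zero, not_not,
    ← exists_mulVec_eq_zero_iff] at h
  obtain ⟨v, hv, h⟩ := h
  refine ⟨v, hv, ?_⟩
  rw [sub_mulVec, Algebra.algebraMap_eq_smul_one, smul_mulVec, one_mulVec, sub_eq_zero] at h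
  exact h.symm

theorem toComplex_mulVec_re {p : ℕ} (M : Matrix (Fin p) (Fin n) ℝ) (v : Fin n → ℂ) :
    (M *ᵥ fun i => (v i).re) = fun i => ((toComplex M *ᵥ v) i).re := by
  ext i; simp [mulVec, dotProduct, toComplex]

theorem toComplex_mulVec_im {p : ℕ} (M : Matrix (Fin p) (Fin n) ℝ) (v : Fin n → ℂ) :
    (M *ᵥ fun i => (v i).im) = fun i => ((toComplex M *ᵥ v) i).im := by
  ext i; simp [mulVec, dotProduct, toComplex]

/-- The Hautus test: an eigenvector of `A` in the kernel of `C` vanishes if `(A, C)` is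
observable. -/
theorem IsObservable.eq_zero_of_eigenvector {p : ℕ} {A : Matrix (Fin n) (Fin n) ℝ}
    {C : Matrix (Fin p) (Fin n) ℝ} (h : IsObservable A C) {v : Fin n → ℂ} {γ : ℂ}
    (hA : toComplex A *ᵥ v = γ • v) (hC : toComplex C *ᵥ v = 0) : v = 0 := by
  have hpow : ∀ j : ℕ, toComplex (C * A ^ j) *ᵥ v = 0 := by
    intro j
    have hj : toComplex A ^ j *ᵥ v = γ ^ j • v := by
      induction j with
      | zero => simp
      | succ j ih => rw [pow_succ, ← mulVec_mulVec, hA, mulVec_smul, ih, smul_smul, pow_succ']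
    rw [toComplex_mul, toComplex_pow, ← mulVec_mulVec, hj, mulVec_smul, hC, smul_zero]
  have hre : (fun i => (v i).re) = 0 := h <| funext fun j => by
    simp only [toComplex_mulVec_re, hpow, mulVec_zero]
    rfl
  have him : (fun i => (v i).im) = 0 := h <| funext fun j => by
    simp only [toComplex_mulVec_im, hpow, mulVec_zero]
    rfl
  exact funext fun i => Complex.ext (congrFun hre i) (congrFun him i)

open scoped ComplexOrder

theorem posSemidef_toComplex {P : Matrix (Fin n) (Fin n) ℝ} (hP : P.PosSemidef) :
    (toComplex P).PosSemidef := by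
  have h : toComplex P = (toComplex (psdSqrt P))ᴴ * toComplex (psdSqrt P) := by
    rw [toComplex_conjTranspose, transpose_eq_of_posSemidef (psdSqrt_spec hP).1, ← toComplex_mul,
      (psdSqrt_spec hP).2]
  rw [h]
  exact posSemidef_conjTranspose_mul_self _

/-- If `P = C + D + Mᵀ P M` and `v` is an eigenvector of `M` whose eigenvalue lies outside the
open unit disc, then `(1 - |γ|²) vᴴ P v = vᴴ C v + vᴴ D v` forces both terms to vanish. -/
theorem mulVec_eq_zero_of_lyapunov {P C D M : Matrix (Fin n) (Fin n) ℝ} (hP : P.PosSemidef)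
    (hC : C.PosSemidef) (hD : D.PosSemidef) (h : P = C + D + Mᵀ * P * M) {v : Fin n → ℂ} {γ : ℂ}
    (hγ : 1 ≤ ‖γ‖) (hv : toComplex M *ᵥ v = γ • v) :
    toComplex C *ᵥ v = 0 ∧ toComplex D *ᵥ v = 0 := by
  have hp := (posSemidef_toComplex hP).dotProduct_mulVec_nonneg v
  have hc := (posSemidef_toComplex hC).dotProduct_mulVec_nonneg v
  have hd := (posSemidef_toComplex hD).dotProduct_mulVec_nonneg v
  rw [← (posSemidef_toComplex hC).dotProduct_mulVec_zero_iff,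
    ← (posSemidef_toComplex hD).dotProduct_mulVec_zero_iff]
  have e : star v ⬝ᵥ toComplex P *ᵥ v = star v ⬝ᵥ toComplex C *ᵥ v + star v ⬝ᵥ toComplex D *ᵥ v
      + ((‖γ‖ ^ 2 : ℝ) : ℂ) * (star v ⬝ᵥ toComplex P *ᵥ v) := by
    have e1 : star v ⬝ᵥ toComplex (Mᵀ * P * M) *ᵥ v =
        ((‖γ‖ ^ 2 : ℝ) : ℂ) * (star v ⬝ᵥ toComplex P *ᵥ v) := by
      rw [toComplex_mul, toComplex_mul, ← toComplex_conjTranspose, ← mulVec_mulVec,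
        ← mulVec_mulVec, dotProduct_mulVec, ← star_mulVec, hv, mulVec_smul, star_smul,
        smul_dotProduct, dotProduct_smul, smul_smul, smul_eq_mul]
      congr 1
      push_cast
      exact Complex.conj_mul' γ
    conv_lhs => rw [h, toComplex_add, toComplex_add, add_mulVec, add_mulVec, dotProduct_add,
      dotProduct_add, e1]
  generalize star v ⬝ᵥ toComplex P *ᵥ v = p at *
  generalize star v ⬝ᵥ toComplex C *ᵥ v = c at *
  generalize star v ⬝ᵥ toComplex D *ᵥ v = d at *
  rw [Complex.nonneg_iff] at hp hc hd
  have e' := congrArg Complex.re e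
  rw [Complex.add_re, Complex.add_re, Complex.re_ofReal_mul] at e'
  have hγ2 : 1 ≤ ‖γ‖ ^ 2 := one_le_pow₀ hγ
  have hpp := mul_le_mul_of_nonneg_right hγ2 hp.1
  exact ⟨Complex.ext (by rw [Complex.zero_re]; linarith [hc.1, hd.1]) hc.2.symm,
    Complex.ext (by rw [Complex.zero_re]; linarith [hc.1, hd.1]) hd.2.symm⟩

theorem mulVec_eq_zero_of_conjTranspose_mul_self {p : ℕ} {C : Matrix (Fin p) (Fin n) ℂ}
    {v : Fin n → ℂ} (h : star v ⬝ᵥ (Cᴴ * C) *ᵥ v = 0) : C *ᵥ v = 0 := by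
  rwa [← mulVec_mulVec, dotProduct_mulVec, ← star_mulVec, dotProduct_star_self_eq_zero] at h

/-- An unstable closed-loop mode is not penalized, hence receives no control, hence is an
unobservable mode of `A`. -/
theorem isSchurStable_closedLoop {A W Q P : Matrix (Fin n) (Fin n) ℝ} (hQ : Q.PosSemidef)
    (hW : W.PosSemidef) (hobs : IsObservable A (psdSqrt Q)) (hP : P.PosSemidef)
    (hfix : P = dareMap A W Q P) : IsSchurStable (toComplex (closedLoop A W P)) := by
  intro γ hγ
  by_contra! hγ1
  obtain ⟨v, hv0, hv⟩ := exists_mulVec_eq_smul_of_mem_spectrum hγ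
  have hPWP : (P * W * P).PosSemidef := by
    simpa [transpose_eq_of_posSemidef hP] using posSemidef_transpose_mul_mul hW P
  have hlyap := hfix.trans (dareMap_eq_lyapunov hP hW)
  obtain ⟨h1, h2⟩ := mulVec_eq_zero_of_lyapunov hP hQ (posSemidef_transpose_mul_mul hPWP _)
    hlyap hγ1 hv
  have hγ0 : γ ≠ 0 := by
    rintro rfl
    simp at hγ1
    linarith
  have h3 : toComplex (psdSqrt Q) *ᵥ v = 0 := by
    apply mulVec_eq_zero_of_conjTranspose_mul_self
    rw [toComplex_conjTranspose, transpose_eq_of_posSemidef (psdSqrt_spec hQ).1, ← toComplex_mul,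
      (psdSqrt_spec hQ).2, h1, dotProduct_zero]
  have h4 : star (toComplex P *ᵥ v) ⬝ᵥ toComplex W *ᵥ (toComplex P *ᵥ v) = 0 := by
    have h5 : star v ⬝ᵥ toComplex ((closedLoop A W P)ᵀ * (P * W * P) * closedLoop A W P) *ᵥ v
        = 0 := by rw [h2, dotProduct_zero]
    rw [toComplex_mul, toComplex_mul, ← toComplex_conjTranspose, ← mulVec_mulVec, ← mulVec_mulVec,
      dotProduct_mulVec, ← star_mulVec, hv, mulVec_smul, star_smul, smul_dotProduct,
      dotProduct_smul, smul_eq_zero_iff_right (star_ne_zero.2 hγ0), smul_eq_zero_iff_right hγ0,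
      toComplex_mul, toComplex_mul, ← mulVec_mulVec, ← mulVec_mulVec, dotProduct_mulVec,
      ← transpose_eq_of_posSemidef hP, ← toComplex_conjTranspose, ← star_mulVec,
      toComplex_conjTranspose, transpose_eq_of_posSemidef hP] at h5
    exact h5
  rw [(posSemidef_toComplex hW).dotProduct_mulVec_zero_iff] at h4
  refine hv0 (hobs.eq_zero_of_eigenvector (γ := γ) ?_ h3)
  rw [← one_add_mul_closedLoop (A := A) hP hW, toComplex_mul, toComplex_add, toComplex_one,
    toComplex_mul, ← mulVec_mulVec, hv, add_mulVec, one_mulVec, ← mulVec_mulVec, mulVec_smul,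
    mulVec_smul, h4, smul_zero, add_zero]

/-- Two fixed points satisfy `P - P' = Lᵀ (P - P') L'` with stable closed loops `L`, `L'`. -/
theorem dareMap_fixedPoint_unique {A W Q P P' : Matrix (Fin n) (Fin n) ℝ} (hQ : Q.PosSemidef)
    (hW : W.PosSemidef) (hobs : IsObservable A (psdSqrt Q)) (hP : P.PosSemidef)
    (hP' : P'.PosSemidef) (hfix : P = dareMap A W Q P) (hfix' : P' = dareMap A W Q P') :
    P = P' := by
  have h := dareMap_sub_dareMap (A := A) (Q := Q) hP hP' hW
  rw [← hfix, ← hfix'] at h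
  exact sub_eq_zero.1 (eq_zero_of_eq_transpose_mul_mul
    (isSchurStable_closedLoop hQ hW hobs hP hfix) (isSchurStable_closedLoop hQ hW hobs hP' hfix') h)

end Observability

/-! ### Convergence of the Riccati iteration -/

section Convergence

variable {n : ℕ} {A S Q : Matrix (Fin n) (Fin n) ℝ}

theorem exists_tendsto_iterate_dareMap_zero (hQ : Q.PosSemidef) (hstab : IsStabilizable A S) :
    ∃ P, Tendsto (fun N => (dareMap A (S * Sᵀ) Q)^[N] 0) atTop (𝓝 P) := by
  obtain ⟨K, hK⟩ := hstab
  obtain ⟨X, hX⟩ := exists_lyapunov_solution hK (Q + Kᵀ * K)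
  exact exists_tendsto_of_monotone
    (fun N => transpose_eq_of_posSemidef
      (posSemidef_iterate_dareMap hQ (posSemidef_mul_transpose_self S) PosSemidef.zero N))
    (monotone_iterate_dareMap_zero hQ)
    (iterate_dareMap_le_feedbackCost hQ PosSemidef.zero K)
    (tendsto_iterate_feedbackCost hK hX 0)

/-- The Riccati iteration converges to a fixed point from every positive semidefinite start: it
lies between the iteration from `0` and the cost of the limiting feedback. -/
theorem exists_dareMap_fixedPoint (hQ : Q.PosSemidef) (hstab : IsStabilizable A S)
    (hobs : IsObservable A (psdSqrt Q)) :
    ∃ P, P.PosSemidef ∧ P = dareMap A (S * Sᵀ) Q P ∧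
      ∀ P₀ : Matrix (Fin n) (Fin n) ℝ, P₀.PosSemidef →
        Tendsto (fun N => (dareMap A (S * Sᵀ) Q)^[N] P₀) atTop (𝓝 P) := by
  have hW := posSemidef_mul_transpose_self S
  obtain ⟨P, hlim⟩ := exists_tendsto_iterate_dareMap_zero hQ hstab
  have hP : P.PosSemidef :=
    posSemidef_of_tendsto (posSemidef_iterate_dareMap hQ hW PosSemidef.zero) hlim
  have hfix : P = dareMap A (S * Sᵀ) Q P := by
    refine tendsto_nhds_unique ((tendsto_add_atTop_iff_nat 1).2 hlim) ?_
    simp only [Function.iterate_succ_apply']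
    exact (continuousAt_dareMap hP hW).tendsto.comp hlim
  refine ⟨P, hP, hfix, fun P₀ hP₀ => ?_⟩
  have hstable : IsSchurStable (toComplex (A + S * optimalGain A S P)) := by
    rw [add_mul_optimalGain hP]
    exact isSchurStable_closedLoop hQ hW hobs hP hfix
  refine tendsto_of_le_of_le
    (fun N => transpose_eq_of_posSemidef (posSemidef_iterate_dareMap hQ hW hP₀ N))
    (transpose_eq_of_posSemidef hP) (fun N => iterate_dareMap_le hQ PosSemidef.zero hP₀ ?_ N)
    (iterate_dareMap_le_feedbackCost hQ hP₀ (optimalGain A S P)) hlim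
    (tendsto_iterate_feedbackCost hstable (hfix.trans (feedbackCost_optimalGain hP).symm) P₀)
  open scoped MatrixOrder in exact hP₀.nonneg

end Convergence

/-! ### The stable deflating subspace -/

section Deflating

/-- The generalized eigenvectors of `M` span, and `V` maps its Jordan chains to those of the
pencil. -/
theorem mulVec_mem_stableDeflatingSubspace {ι : Type*} [Fintype ι] {n : ℕ} {F G : Matrix ι ι ℂ}
    {V : Matrix ι (Fin n) ℂ} {M : Matrix (Fin n) (Fin n) ℂ} (h : F * V = G * V * M)
    (hM : IsSchurStable M) (w : Fin n → ℂ) : V *ᵥ w ∈ stableDeflatingSubspace F G := by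
  suffices H : ⊤ ≤ (stableDeflatingSubspace F G).comap V.mulVecLin from
    H (Submodule.mem_top (x := w))
  rw [← Module.End.iSup_maxGenEigenspace_eq_top (toLin' M)]
  refine iSup_le fun γ x hx => ?_
  rw [Submodule.mem_comap, mulVecLin_apply]
  obtain ⟨k, hk⟩ := (Module.End.mem_maxGenEigenspace _ _ _).1 hx
  obtain ⟨N, hN⟩ : ∃ N, N = M - γ • (1 : Matrix (Fin n) (Fin n) ℂ) := ⟨_, rfl⟩
  have hk' : N ^ k *ᵥ x = 0 := by
    rw [← hk, ← toLin'_apply, toLin'_pow, hN]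
    simp [Module.End.one_eq_id]
  by_cases hu : IsUnit N
  · have hx0 : x = 0 := by
      have := mulVec_injective_iff_isUnit.2 (hu.pow k)
      exact this (by rw [hk', mulVec_zero])
    rw [hx0, mulVec_zero]
    exact zero_mem _
  · refine Submodule.subset_span ⟨γ, hM γ ?_, k, fun j => V *ᵥ (N ^ (k - j) *ᵥ x), ?_, ?_, ?_⟩
    · rw [spectrum.mem_iff, Algebra.algebraMap_eq_smul_one, ← neg_sub, ← hN]
      exact fun h => hu (by simpa using h.neg)
    · simp [hk']
    · simp
    · intro j hj
      beta_reduce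
      have e : k - j = (k - (j + 1)) + 1 := by omega
      have hMN : M = γ • 1 + N := by rw [hN]; abel
      rw [e, pow_succ', ← mulVec_mulVec]
      generalize N ^ (k - (j + 1)) *ᵥ x = y
      rw [mulVec_mulVec, h, ← mulVec_mulVec]
      conv_lhs => rw [hMN]
      rw [add_mulVec, mulVec_add, smul_mulVec, one_mulVec, mulVec_smul, ← mulVec_mulVec,
        ← mulVec_mulVec]

variable {n : ℕ}

theorem IsSchurStable.eq_zero_of_eq_smul_transpose_mulVec {M : Matrix (Fin n) (Fin n) ℂ}
    (hM : IsSchurStable M) {γ : ℂ} (hγ : ‖γ‖ < 1) {z : Fin n → ℂ} (hz : z = γ • (Mᵀ *ᵥ z)) :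
    z = 0 := by
  have h : ∀ N : ℕ, γ ^ N • ((M ^ N)ᵀ *ᵥ z) = z := by
    intro N
    induction N with
    | zero => simp
    | succ N ih =>
      conv_rhs => rw [← ih, hz]
      rw [pow_succ' M, transpose_mul, mulVec_smul, smul_smul, mulVec_mulVec, pow_succ]
  have hc : Continuous fun X : Matrix (Fin n) (Fin n) ℂ => Xᵀ *ᵥ z := by fun_prop
  have h1 := (tendsto_pow_atTop_nhds_zero_of_norm_lt_one hγ).smul
    ((hc.tendsto 0).comp hM.tendsto_pow)
  simp only [Function.comp_def, h, zero_smul] at h1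
  exact tendsto_nhds_unique tendsto_const_nhds h1

/-- Along a Jordan chain with `|γ| < 1` of the pencil, the deviation `z = y - P x` of a chain
vector `(x, y)` from the graph of `P` satisfies `z = γ Lᵀ z`, once its predecessor lies on the
graph. Since `L` is stable, `z = 0`. -/
theorem IsRootVector.mem_graph {A W Q P L : Matrix (Fin n) (Fin n) ℂ}
    (h1 : (1 + W * P) * L = A) (h2 : Lᵀ * (1 + P * W) = Aᵀ) (h3 : P = Q + Aᵀ * P * L)
    (hL : IsSchurStable L) {γ : ℂ} (hγ : ‖γ‖ < 1) {v : Fin n ⊕ Fin n → ℂ}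
    (hv : IsRootVector (fromBlocks A 0 (-Q) 1) (fromBlocks 1 W 0 Aᵀ) γ v) :
    v ∘ Sum.inr = P *ᵥ (v ∘ Sum.inl) := by
  obtain ⟨l, c, hc0, rfl, hc⟩ := hv
  suffices H : ∀ j ≤ l, c j ∘ Sum.inr = P *ᵥ (c j ∘ Sum.inl) from H l le_rfl
  intro j
  induction j with
  | zero =>
    intro _
    rw [hc0]
    exact (mulVec_zero P).symm
  | succ j ih =>
    intro hj
    have hy := ih (by omega)
    have hF := hc j (by omega)
    rw [fromBlocks_mulVec, fromBlocks_mulVec, fromBlocks_mulVec] at hF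
    have hF1 := congrArg (· ∘ Sum.inl) hF
    have hF2 := congrArg (· ∘ Sum.inr) hF
    clear hF
    replace hF1 : A *ᵥ (c (j + 1) ∘ Sum.inl) + 0 *ᵥ (c (j + 1) ∘ Sum.inr) =
      γ • (1 *ᵥ (c (j + 1) ∘ Sum.inl) + W *ᵥ (c (j + 1) ∘ Sum.inr)) +
        (1 *ᵥ (c j ∘ Sum.inl) + W *ᵥ (c j ∘ Sum.inr)) := hF1
    replace hF2 : (-Q) *ᵥ (c (j + 1) ∘ Sum.inl) + 1 *ᵥ (c (j + 1) ∘ Sum.inr) =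
      γ • (0 *ᵥ (c (j + 1) ∘ Sum.inl) + Aᵀ *ᵥ (c (j + 1) ∘ Sum.inr)) +
        (0 *ᵥ (c j ∘ Sum.inl) + Aᵀ *ᵥ (c j ∘ Sum.inr)) := hF2
    rw [hy] at hF1 hF2
    generalize c (j + 1) ∘ Sum.inl = x' at *
    generalize c j ∘ Sum.inl = x at *
    obtain ⟨z, hz⟩ : ∃ z, c (j + 1) ∘ Sum.inr = P *ᵥ x' + z :=
      ⟨c (j + 1) ∘ Sum.inr - P *ᵥ x', by abel⟩
    rw [hz] at hF1 hF2 ⊢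
    have hF1' : (1 + W * P) *ᵥ (L *ᵥ x' - γ • x' - x) = γ • (W *ᵥ z) := by
      rw [← h1] at hF1
      simp only [mulVec_add, mulVec_sub, add_mulVec, mulVec_smul, one_mulVec, zero_mulVec,
        ← mulVec_mulVec] at hF1 ⊢
      linear_combination (norm := module) hF1
    have hF2' : Aᵀ *ᵥ (P *ᵥ (L *ᵥ x' - γ • x' - x)) + z = γ • (Aᵀ *ᵥ z) := by
      have h3' : P *ᵥ x' = Q *ᵥ x' + Aᵀ *ᵥ (P *ᵥ (L *ᵥ x')) := by
        conv_lhs => rw [h3]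
        simp only [add_mulVec, mulVec_mulVec, Matrix.mul_assoc]
      rw [mulVec_add Aᵀ, neg_mulVec, one_mulVec] at hF2
      simp only [mulVec_sub, mulVec_smul, zero_mulVec] at hF2 ⊢
      linear_combination (norm := module) hF2 - h3'
    have hAP : Aᵀ *ᵥ (P *ᵥ (L *ᵥ x' - γ • x' - x)) = γ • (Lᵀ *ᵥ (P *ᵥ (W *ᵥ z))) := by
      have e : Lᵀ * (1 + P * W) * P = Lᵀ * (P * (1 + W * P)) := by noncomm_ring
      rw [← h2, mulVec_mulVec, e, ← mulVec_mulVec, ← mulVec_mulVec, hF1', mulVec_smul,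
        mulVec_smul]
    have hAz : Aᵀ *ᵥ z = Lᵀ *ᵥ z + Lᵀ *ᵥ (P *ᵥ (W *ᵥ z)) := by
      rw [← h2, ← mulVec_mulVec, add_mulVec, one_mulVec, mulVec_add, ← mulVec_mulVec]
    have hz0 : z = 0 := hL.eq_zero_of_eq_smul_transpose_mulVec hγ (by
      rw [hAP, hAz] at hF2'
      linear_combination (norm := module) hF2')
    rw [hz0, add_zero]

theorem fromRows_one_mulVec (P : Matrix (Fin n) (Fin n) ℂ) (w : Fin n → ℂ) :
    fromRows (1 : Matrix (Fin n) (Fin n) ℂ) P *ᵥ w = Sum.elim w (P *ᵥ w) := by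
  rw [fromRows_mulVec, one_mulVec]

theorem pencil_mul_fromRows {𝕜 : Type*} [CommRing 𝕜] {A W Q P L : Matrix (Fin n) (Fin n) 𝕜}
    (h1 : (1 + W * P) * L = A) (h3 : P = Q + Aᵀ * P * L) :
    (fromBlocks A 0 (-Q) 1 : Matrix (Fin n ⊕ Fin n) (Fin n ⊕ Fin n) 𝕜) *
        (fromRows 1 P : Matrix (Fin n ⊕ Fin n) (Fin n) 𝕜) =
      (fromBlocks 1 W 0 Aᵀ : Matrix (Fin n ⊕ Fin n) (Fin n ⊕ Fin n) 𝕜) *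
        (fromRows 1 P : Matrix (Fin n ⊕ Fin n) (Fin n) 𝕜) * L := by
  have h4 : -Q + P = Aᵀ * P * L := by nth_rw 1 [h3]; abel
  rw [fromBlocks_mul_fromRows, fromBlocks_mul_fromRows, fromRows_mul]
  simp [h1, h4]

/-- The stable deflating subspace is the graph of the stabilizing solution. -/
theorem mem_stableDeflatingSubspace_iff {A W Q P L : Matrix (Fin n) (Fin n) ℂ}
    (h1 : (1 + W * P) * L = A) (h2 : Lᵀ * (1 + P * W) = Aᵀ) (h3 : P = Q + Aᵀ * P * L)
    (hL : IsSchurStable L) {v : Fin n ⊕ Fin n → ℂ} :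
    v ∈ stableDeflatingSubspace (fromBlocks A 0 (-Q) 1) (fromBlocks 1 W 0 Aᵀ) ↔
      v ∘ Sum.inr = P *ᵥ (v ∘ Sum.inl) := by
  constructor
  · intro hv
    induction hv using Submodule.span_induction with
    | mem v hv =>
      obtain ⟨γ, hγ, hv⟩ := hv
      exact hv.mem_graph h1 h2 h3 hL hγ
    | zero => exact (mulVec_zero P).symm
    | add v w _ _ hv hw =>
      have e : (v + w) ∘ Sum.inl = v ∘ Sum.inl + w ∘ Sum.inl := rfl
      rw [e, mulVec_add, ← hv, ← hw]
      rfl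
    | smul a v _ hv =>
      have e : (a • v) ∘ Sum.inl = a • (v ∘ Sum.inl) := rfl
      rw [e, mulVec_smul, ← hv]
      rfl
  · intro hv
    have e : v = fromRows (1 : Matrix (Fin n) (Fin n) ℂ) P *ᵥ (v ∘ Sum.inl) := by
      rw [fromRows_one_mulVec, ← hv, Sum.elim_comp_inl_inr]
    rw [e]
    exact mulVec_mem_stableDeflatingSubspace (pencil_mul_fromRows h1 h3) hL _

theorem eq_mul_of_mulVec_mem_graph {P V₁ V₂ : Matrix (Fin n) (Fin n) ℂ}
    (h : ∀ w, (fromRows V₁ V₂ *ᵥ w) ∘ Sum.inr = P *ᵥ ((fromRows V₁ V₂ *ᵥ w) ∘ Sum.inl)) :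
    V₂ = P * V₁ := by
  refine ext_of_mulVec_single fun i => ?_
  have := h (Pi.single i 1)
  rw [fromRows_mulVec, Sum.elim_comp_inr, Sum.elim_comp_inl, mulVec_mulVec] at this
  exact this

end Deflating

/-! ### The Riccati equation and the pencil in terms of `W` -/

section Translation

variable {n m k : ℕ} {A : Matrix (Fin n) (Fin n) ℝ} {B : Matrix (Fin n) (Fin m) ℝ}
  {Ξ : Matrix (Fin n) (Fin k) ℝ} {Q : Matrix (Fin n) (Fin n) ℝ}
  {R : Matrix (Fin m) (Fin m) ℝ} {lam : ℝ}

theorem bracket_eq (P : Matrix (Fin n) (Fin n) ℝ) :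
    bracket B Ξ R lam P = 1 + P * matW B Ξ R lam := by
  simp only [bracket, matW, Matrix.mul_sub, Matrix.mul_smul, Matrix.mul_assoc]
  abel

theorem riccatiMap_eq_dareMap :
    riccatiMap A B Ξ Q R lam = dareMap A (matW B Ξ R lam) Q := by
  ext1 P
  rw [riccatiMap, dareMap, bracket_eq]

theorem toComplex_pencilF :
    toComplex (pencilF A Q) = fromBlocks (toComplex A) 0 (-toComplex Q) 1 := by
  have h0 : toComplex (0 : Matrix (Fin n) (Fin n) ℝ) = 0 := by ext; simp [toComplex]
  have hn : toComplex (-Q) = -toComplex Q := by ext; simp [toComplex]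
  rw [← toComplex_one, ← h0, ← hn]
  exact fromBlocks_map _ _ _ _ _

theorem toComplex_pencilG :
    toComplex (pencilG A B Ξ R lam) =
      fromBlocks 1 (toComplex (matW B Ξ R lam)) 0 (toComplex A)ᵀ := by
  have h0 : toComplex (0 : Matrix (Fin n) (Fin n) ℝ) = 0 := by ext; simp [toComplex]
  rw [← toComplex_one, ← h0, ← toComplex_transpose]
  exact fromBlocks_map _ _ _ _ _

end Translation

end MinimaxLQ

theorem theorem3 {n m k : ℕ}
    (A : Matrix (Fin n) (Fin n) ℝ) (B : Matrix (Fin n) (Fin m) ℝ)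
    (Ξ : Matrix (Fin n) (Fin k) ℝ) (Q : Matrix (Fin n) (Fin n) ℝ)
    (R : Matrix (Fin m) (Fin m) ℝ) (Qf : Matrix (Fin n) (Fin n) ℝ) (lam : ℝ)
    (hQ : Q.PosSemidef) (hR : R.PosDef) (hQf : Qf.PosSemidef) (hlam : 0 < lam)
    -- the penalty parameter exceeds all eigenvalues of `Ξᵀ P_t Ξ`
    (hpen : ∀ T t : ℕ, t ≤ T →
      ∀ μ ∈ spectrum ℝ (Ξᵀ * riccati A B Ξ Q R lam Qf T t * Ξ), μ < lam)
    (hW : (matW B Ξ R lam).PosSemidef)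
    (hstab : IsStabilizable A (psdSqrt (matW B Ξ R lam)))
    (hobs : IsObservable A (psdSqrt Q)) :
    -- the recursion is well defined
    (∀ T t : ℕ, t < T →
      IsUnit (bracket B Ξ R lam (riccati A B Ξ Q R lam Qf T (t + 1)))) ∧
    ∃ Pss : Matrix (Fin n) (Fin n) ℝ,
      -- `Pss` is the unique symmetric positive semidefinite solution of the ARE
      Pss.PosSemidef ∧ IsARESolution A B Ξ Q R lam Pss ∧
      (∀ P : Matrix (Fin n) (Fin n) ℝ,
        P.PosSemidef → IsARESolution A B Ξ Q R lam P → P = Pss) ∧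
      -- the recursion converges to it as the horizon tends to infinity
      (∀ t : ℕ, Tendsto (fun T : ℕ => riccati A B Ξ Q R lam Qf T t) atTop (𝓝 Pss)) ∧
      -- real matrices `V₁, V₂` spanning the stable deflating subspace of `(F, G)` exist,
      -- and they satisfy `F V = G V M` with a stable matrix `M`
      (∃ V₁ V₂ M : Matrix (Fin n) (Fin n) ℝ,
        ColumnsSpanStable (toComplex (pencilF A Q)) (toComplex (pencilG A B Ξ R lam))
          (toComplex (Matrix.fromRows V₁ V₂)) ∧
        pencilF A Q * Matrix.fromRows V₁ V₂ =
          pencilG A B Ξ R lam * Matrix.fromRows V₁ V₂ * M ∧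
        IsSchurStable (toComplex M) ∧ IsUnit V₁ ∧ Pss = V₂ * V₁⁻¹) ∧
      -- `Pss = V₂ V₁⁻¹` for all `V₁, V₂` whose columns span the stable deflating subspace
      (∀ V₁ V₂ : Matrix (Fin n) (Fin n) ℂ,
        ColumnsSpanStable (toComplex (pencilF A Q)) (toComplex (pencilG A B Ξ R lam))
          (Matrix.fromRows V₁ V₂) →
        IsUnit V₁ ∧ toComplex Pss = V₂ * V₁⁻¹) ∧
      -- the same for all `V` of full column rank with `F V = G V M` and `M` stable
      (∀ V₁ V₂ M : Matrix (Fin n) (Fin n) ℂ,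
        LinearIndependent ℂ (Matrix.fromRows V₁ V₂).col →
        toComplex (pencilF A Q) * Matrix.fromRows V₁ V₂ =
          toComplex (pencilG A B Ξ R lam) * Matrix.fromRows V₁ V₂ * M →
        IsSchurStable M →
        IsUnit V₁ ∧ toComplex Pss = V₂ * V₁⁻¹) := by
  obtain ⟨W, hWdef⟩ : ∃ W, W = matW B Ξ R lam := ⟨_, rfl⟩
  simp only [riccati, IsARESolution, riccatiMap_eq_dareMap, bracket_eq, toComplex_pencilF,
    toComplex_pencilG]
  have hGdef : pencilG A B Ξ R lam = fromBlocks 1 W 0 Aᵀ := by rw [hWdef]; rfl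
  rw [hGdef]
  rw [← hWdef] at hW hstab ⊢
  have hSS : psdSqrt W * (psdSqrt W)ᵀ = W := by
    rw [transpose_eq_of_posSemidef (psdSqrt_spec hW).1, (psdSqrt_spec hW).2]
  obtain ⟨P, hP, hfix, hlim⟩ := exists_dareMap_fixedPoint hQ hstab hobs
  rw [hSS] at hfix hlim
  have hstable := isSchurStable_closedLoop hQ hW hobs hP hfix
  -- the three identities that describe the pencil, over `ℝ` and over `ℂ`
  have h1 := one_add_mul_closedLoop (A := A) hP hW
  have h2 := transpose_closedLoop_mul (A := A) hP hW
  have h3 : P = Q + Aᵀ * P * closedLoop A W P := hfix.trans (dareMap_eq_mul_closedLoop hP hW)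
  have h1c := congrArg toComplex h1
  have h2c := congrArg toComplex h2
  have h3c := congrArg toComplex h3
  simp only [toComplex_mul, toComplex_add, toComplex_one, toComplex_transpose] at h1c h2c h3c
  have hgraph := fun v => mem_stableDeflatingSubspace_iff h1c h2c h3c hstable (v := v)
  refine ⟨fun T t _ => isUnit_one_add_mul (posSemidef_iterate_dareMap hQ hW hQf _) hW, P, hP,
    ⟨isUnit_one_add_mul hP hW, hfix⟩,
    fun P' hP' h => dareMap_fixedPoint_unique hQ hW hobs hP' hP h.2 hfix,
    fun t => (hlim Qf hQf).comp (tendsto_sub_atTop_nat t),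
    ⟨1, P, closedLoop A W P, ?_, ?_, hstable, isUnit_one, by simp⟩, ?_, ?_⟩
  · have e : toComplex (fromRows (1 : Matrix (Fin n) (Fin n) ℝ) P) = fromRows 1 (toComplex P) := by
      rw [← toComplex_one]
      ext (i | i) j <;> rfl
    rw [ColumnsSpanStable, e, ← range_mulVecLin]
    ext v
    rw [hgraph, LinearMap.mem_range]
    constructor
    · rintro ⟨w, rfl⟩
      rw [mulVecLin_apply, fromRows_one_mulVec, Sum.elim_comp_inr, Sum.elim_comp_inl]
    · intro hv
      exact ⟨v ∘ Sum.inl, by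
        rw [mulVecLin_apply, fromRows_one_mulVec, ← hv, Sum.elim_comp_inl_inr]⟩
  · exact pencil_mul_fromRows h1 h3
  · intro V₁ V₂ hV
    rw [ColumnsSpanStable, ← range_mulVecLin] at hV
    have hV₂ : V₂ = toComplex P * V₁ := eq_mul_of_mulVec_mem_graph fun w => by
      rw [← hgraph, ← hV]
      exact ⟨w, rfl⟩
    have hu : IsUnit V₁ := by
      rw [← mulVec_surjective_iff_isUnit]
      intro x
      have hx : Sum.elim x (toComplex P *ᵥ x) ∈ LinearMap.range (fromRows V₁ V₂).mulVecLin := by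
        rw [hV, hgraph, Sum.elim_comp_inr, Sum.elim_comp_inl]
      obtain ⟨w, hw⟩ := hx
      rw [mulVecLin_apply, fromRows_mulVec] at hw
      exact ⟨w, congrArg (· ∘ Sum.inl) hw⟩
    exact ⟨hu, by rw [hV₂, mul_nonsing_inv_cancel_right _ _ ((isUnit_iff_isUnit_det _).1 hu)]⟩
  · intro V₁ V₂ M hV hFG hM
    have hV₂ : V₂ = toComplex P * V₁ := eq_mul_of_mulVec_mem_graph fun w => by
      rw [← hgraph]
      exact mulVec_mem_stableDeflatingSubspace hFG hM w
    have hu : IsUnit V₁ := by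
      rw [← mulVec_injective_iff] at hV
      rw [← mulVec_injective_iff_isUnit]
      intro x y hxy
      apply hV
      rw [fromRows_mulVec, fromRows_mulVec, hV₂, ← mulVec_mulVec, ← mulVec_mulVec]
      rw [hxy]
    exact ⟨hu, by rw [hV₂, mul_nonsing_inv_cancel_right _ _ ((isUnit_iff_isUnit_det _).1 hu)]⟩
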